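/- Let $\mathfrak R=(R,0,1,+,\cdot,<,\dots)$ be an expansion of an ordered field $R$ (a first-order structure on $R$ whose language contains symbols for $0,1,+,\cdot,<$ with their usual interpretation). "Definable" means definable in $\mathfrak R$ by a first-order formula, possibly with parameters from $R$. Suppose that $\mathfrak R$ is definably complete, that is, every non-empty definable subset of $R$ which is bounded from above has a least upper bound in $R$. (The field $R$ is then necessarily real closed.) Equip $R$ with the order topology and $R^n$ ($n\in\mathbb N=\{0,1,2,\dots\}$) with the product topology; call $S\subseteq R^n$ bounded if there is some $\varrho>0$ in $R$ with $x_1^2+\cdots+x_n^2<\varrho^2$ for all $x\in S$, and convex if $\lambda x+(1-\lambda)y\in S$ for all $x,y\in S$ and all $\lambda\in R$ with $0\le\lambda\le 1$. Let $\mathcal C=\{C_a\}_{a\in A}$ be a definable family of closed, bounded, convex subsets of $R^n$; that is, $A\subseteq R^m$ is definable for some $m\in\mathbb N$, the set $\{(a,x)\in R^m\times R^n : a\in A,\ x\in C_a\}$ is definable, and each $C_a$ with $a\in A$ is a closed, bounded, convex subset of $R^n$. If any collection of at most $n+1$ sets from $\mathcal C$ has a non-empty intersection, then $\mathcal C$ has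 a non-empty intersection: $\bigcap_{a\in A}C_a\neq\emptyset$ (the intersection of the empty collection being $R^n$). -/

import Mathlib

universe u v w

namespace DefHelly

/-- The function symbols `0, 1, +, ·` of ordered fields. -/
inductive OrdFieldFunc : ℕ → Type
  | zero : OrdFieldFunc 0
  | one : OrdFieldFunc 0
  | add : OrdFieldFunc 2
  | mul : OrdFieldFunc 2

/-- The relation symbol `<` of ordered fields. -/
inductive OrdFieldRel : ℕ → Type
  | lt : OrdFieldRel 2

/-- The first-order language `{0, 1, +, ·, <}`. -/
def ordField : FirstOrder.Language.{0, 0} := ⟨OrdFieldFunc, OrdFieldRel⟩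

/-- An ordered field as a structure in the language `{0, 1, +, ·, <}`, each symbol having its
usual meaning. -/
instance ordFieldStructure (R : Type w) [Field R] [LinearOrder R] : ordField.Structure R where
  funMap := fun f x =>
    match f, x with
    | OrdFieldFunc.zero, _ => 0
    | OrdFieldFunc.one, _ => 1
    | OrdFieldFunc.add, x => x 0 + x 1
    | OrdFieldFunc.mul, x => x 0 * x 1
  RelMap := fun r x =>
    match r, x with
    | OrdFieldRel.lt, x => x 0 < x 1

/-- `S` is definable in the `L`-structure `R`, possibly with parameters. The index type `α` is
finite in all uses, so that `α → R` is a finite Cartesian power of `R`. -/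
def IsDefinable (L : FirstOrder.Language.{u, v}) {R : Type w} [L.Structure R] {α : Type}
    (S : Set (α → R)) : Prop :=
  (Set.univ : Set R).Definable L S

/-- The `L`-structure `R` is definably complete: every non-empty definable subset of `R` which is
bounded from above has a least upper bound in `R`. -/
def DefinablyComplete (L : FirstOrder.Language.{u, v}) (R : Type w) [L.Structure R]
    [LinearOrder R] : Prop :=
  ∀ S : Set R, (Set.univ : Set R).Definable₁ L S → S.Nonempty → BddAbove S → ∃ b : R, IsLUB S b

/-- `{C a}_{a ∈ A}` is a definable family of subsets of `R^n`, with index set `A ⊆ R^m`: both `A`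
and the set of all pairs `(a, x)` in `R^m × R^n` with `a ∈ A` and `x ∈ C a` are definable. The
product `R^m × R^n` is the Cartesian power of `R` with coordinates indexed by `Fin m ⊕ Fin n`. -/
def IsDefinableFamily (L : FirstOrder.Language.{u, v}) {R : Type w} [L.Structure R] {m n : ℕ}
    (A : Set (Fin m → R)) (C : (Fin m → R) → Set (Fin n → R)) : Prop :=
  IsDefinable L A ∧
    IsDefinable L {p : Fin m ⊕ Fin n → R |
      (fun i => p (Sum.inl i)) ∈ A ∧ (fun j => p (Sum.inr j)) ∈ C (fun i => p (Sum.inl i))}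

/-- `S ⊆ R^n` is contained in the open ball `{x : ‖x‖ < ρ}` for some `ρ > 0`, where
`‖x‖ ^ 2 = x₁ ^ 2 + ⋯ + xₙ ^ 2`; the inequality is squared, so no square roots are needed. -/
def IsBoundedSet {R : Type w} [Field R] [LinearOrder R] {n : ℕ} (S : Set (Fin n → R)) : Prop :=
  ∃ ρ : R, 0 < ρ ∧ ∀ x ∈ S, ∑ i, x i ^ 2 < ρ ^ 2

end DefHelly

namespace DefHelly

open FirstOrder FirstOrder.Language Set

/-! ### Closure properties of definable sets and functions. -/

section Definability

variable {L : FirstOrder.Language.{u, v}} {R : Type w} [L.Structure R] {α β : Type}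

/-! Induction on the dimension, slicing by a hyperplane. In dimension `n + 1`, classical Helly makes
every finite subfamily intersect. Let `s` be the supremum, over all `(n + 1)`-tuples from the
family, of the minimum of `x 0` on the intersection of the tuple. Fixing the length of the tuples
keeps this a first-order condition, so definable completeness provides `s`.

Every such intersection meets `x 0 = s`: its minimum is at most `s`, it meets the intersections of
tuples whose minima approach `s`, and it is convex and definably compact
(`DefinablyComplete.exists_mem_zero_eq`). So the slices at `x 0 = s` satisfy the hypothesis in
dimension `n`, and a common point of the slices is a common point of the family. -/

theorem IsDefinable.and {P Q : (α → R) → Prop} (hP : IsDefinable L {v | P v})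
    (hQ : IsDefinable L {v | Q v}) : IsDefinable L {v | P v ∧ Q v} :=
  Set.Definable.inter hP hQ

theorem IsDefinable.not {P : (α → R) → Prop} (hP : IsDefinable L {v | P v}) :
    IsDefinable L {v | ¬ P v} :=
  Set.Definable.compl hP

theorem IsDefinable.imp {P Q : (α → R) → Prop} (hP : IsDefinable L {v | P v})
    (hQ : IsDefinable L {v | Q v}) : IsDefinable L {v | P v → Q v} := by
  convert! (hP.and hQ.not).not using 2
  simp

theorem IsDefinable.forall_finite {κ : Type} [Finite κ] {P : κ → (α → R) → Prop}
    (hP : ∀ k, IsDefinable L {v | P k v}) : IsDefinable L {v | ∀ k, P k v} := by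
  convert! Set.definable_iInter_of_finite hP using 1
  ext v
  simp

theorem IsDefinable.comp [Finite β] {S : Set (β → R)} (hS : IsDefinable L S)
    {F : β → (α → R) → R} (hF : ∀ b, (univ : Set R).DefinableFun L (F b)) :
    IsDefinable L {v | (fun b => F b v) ∈ S} :=
  Set.Definable.preimage_map (F := fun v b => F b v) hF hS

theorem IsDefinable.exists_tuple [Finite β] {P : (α → R) → (β → R) → Prop}
    (hP : IsDefinable L {w : α ⊕ β → R |
      P (fun i => w (Sum.inl i)) (fun j => w (Sum.inr j))}) :
    IsDefinable L {v | ∃ y, P v y} :=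
  Set.Definable.exists_of_finite hP

theorem IsDefinable.forall_tuple [Finite β] {P : (α → R) → (β → R) → Prop}
    (hP : IsDefinable L {w : α ⊕ β → R |
      P (fun i => w (Sum.inl i)) (fun j => w (Sum.inr j))}) :
    IsDefinable L {v | ∀ y, P v y} :=
  Set.Definable.forall_of_finite hP

theorem IsDefinable.exists_elem {P : (α → R) → R → Prop}
    (hP : IsDefinable L {w : α ⊕ Unit → R | P (fun i => w (Sum.inl i)) (w (Sum.inr ()))}) :
    IsDefinable L {v | ∃ y, P v y} := by
  have := IsDefinable.exists_tuple (P := fun v (y : Unit → R) => P v (y ())) hP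
  convert! this using 4
  exact ⟨fun ⟨y, hy⟩ => ⟨fun _ => y, hy⟩, fun ⟨y, hy⟩ => ⟨y (), hy⟩⟩

theorem definableFun_const (a : R) : (univ : Set R).DefinableFun L (fun _ : α → R => a) :=
  FirstOrder.Language.definableFun_const L α (mem_univ a)

theorem definableFun_coord {i : α} : (univ : Set R).DefinableFun L (fun v : α → R => v i) :=
  Set.DefinableFun.proj L

theorem IsDefinable.const (p : Prop) : IsDefinable L {_v : α → R | p} := by
  by_cases hp : p
  · simp [IsDefinable, hp]
  · simp [IsDefinable, hp]

theorem IsDefinableFamily.mem {m n : ℕ} {A : Set (Fin m → R)} {C : (Fin m → R) → Set (Fin n → R)}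
    (h : IsDefinableFamily L A C) {f : Fin m → (α → R) → R} {g : Fin n → (α → R) → R}
    (hf : ∀ j, (univ : Set R).DefinableFun L (f j))
    (hg : ∀ i, (univ : Set R).DefinableFun L (g i)) :
    IsDefinable L {v | (fun j => f j v) ∈ A ∧ (fun i => g i v) ∈ C (fun j => f j v)} :=
  h.2.comp (F := Sum.elim f g) (by rintro (j | i); exacts [hf j, hg i])

variable [LinearOrder R]

theorem DefinablyComplete.exists_isLUB (hR : DefinablyComplete L R) {P : R → Prop}
    (hP : IsDefinable L {v : Fin 1 → R | P (v 0)}) (hne : ∃ t, P t)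
    (hbdd : ∃ b, ∀ t, P t → t ≤ b) : ∃ s, IsLUB {t | P t} s :=
  hR {t | P t} hP hne hbdd

variable [Field R]

theorem definableFun_add (ι : ordField →ᴸ L) [ι.IsExpansionOn R] {f g : (α → R) → R}
    (hf : (univ : Set R).DefinableFun L f) (hg : (univ : Set R).DefinableFun L g) :
    (univ : Set R).DefinableFun L (fun v => f v + g v) := by
  have h : (univ : Set R).DefinableFun L (fun v : Fin 2 → R => v 0 + v 1) := by
    refine Set.DefinableFun.of_empty ?_
    convert! Set.DefinableFun.fun_symbol (ι.onFunction (n := 2) OrdFieldFunc.add) using 1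
    ext v
    exact (LHom.map_onFunction (n := 2) ι OrdFieldFunc.add v).symm
  exact Set.DefinableFun.comp (g := fun v => ![f v, g v])
    (by intro i; fin_cases i <;> simpa) h

theorem isDefinable_lt (ι : ordField →ᴸ L) [ι.IsExpansionOn R] {f g : (α → R) → R}
    (hf : (univ : Set R).DefinableFun L f) (hg : (univ : Set R).DefinableFun L g) :
    IsDefinable L {v | f v < g v} := by
  have h : IsDefinable L {v : Fin 2 → R | v 0 < v 1} := by
    refine Set.Definable.mono (Set.empty_definable_iff.2 ?_) (empty_subset _)
    refine ⟨Relations.formula₂ (ι.onRelation (n := 2) OrdFieldRel.lt) (Term.var 0) (Term.var 1), ?_⟩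
    ext v
    refine Iff.trans ?_ Formula.realize_rel₂.symm
    exact (LHom.map_onRelation (n := 2) ι (M := R) OrdFieldRel.lt ![v 0, v 1]).symm.to_iff
  exact h.comp (F := ![f, g]) (by intro i; fin_cases i <;> simpa)

end Definability

/-! ### Definable compactness of closed bounded sets. -/

section Compactness

variable {L : FirstOrder.Language.{u, v}} {R : Type w} [Field R] [LinearOrder R]
  [IsStrictOrderedRing R] [L.Structure R]

/-- A uniformly bounded definable decreasing family `K t`, `t → 0⁺`, of non-empty sets clusters
at some point. -/
theorem DefinablyComplete.exists_cluster_point (hR : DefinablyComplete L R)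
    (ι : ordField →ᴸ L) [ι.IsExpansionOn R] {n : ℕ} {K : R → Set (Fin n → R)}
    (hK : IsDefinable L {p : Unit ⊕ Fin n → R | (fun i => p (Sum.inr i)) ∈ K (p (Sum.inl ()))})
    (hmono : ∀ s t, 0 < s → s ≤ t → K s ⊆ K t) (hne : ∀ t, 0 < t → (K t).Nonempty)
    {ρ : R} (hρ : ∀ t, 0 < t → ∀ x ∈ K t, ∀ i, |x i| ≤ ρ) :
    ∃ c : Fin n → R, ∀ t, 0 < t → ∃ x ∈ K t, ∀ i, |x i - c i| < t := by
  suffices H : ∀ s : Finset (Fin n), ∃ c : Fin n → R, ∀ t, 0 < t →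
      ∃ x ∈ K t, ∀ i ∈ s, x i < c i + t ∧ c i < x i + t by
    obtain ⟨c, hc⟩ := H Finset.univ
    refine ⟨c, fun t ht => ?_⟩
    obtain ⟨x, hx, h⟩ := hc t ht
    refine ⟨x, hx, fun i => abs_sub_lt_iff.2 ?_⟩
    obtain ⟨h1, h2⟩ := h i (Finset.mem_univ i)
    constructor <;> linarith
  intro s
  induction s using Finset.induction_on with
  | empty =>
    refine ⟨0, fun t ht => ?_⟩
    obtain ⟨x, hx⟩ := hne t ht
    exact ⟨x, hx, by simp⟩
  | insert j s hj ih =>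
    obtain ⟨c, hc⟩ := ih
    -- The new coordinate `d` is the lower limit, as `t → 0⁺`, of `x j` over the points of `K t`
    -- that are `t`-close to `c` on `s`.
    obtain ⟨d, hd⟩ := hR.exists_isLUB (P := fun u => ∃ t, 0 < t ∧ ∀ x : Fin n → R,
      (x ∈ K t ∧ ∀ i, i ∈ s → x i < c i + t ∧ c i < x i + t) → ¬ x j < u)
      (by
        refine .exists_elem (P := fun (v : Fin 1 → R) t => 0 < t ∧ ∀ x : Fin n → R,
          (x ∈ K t ∧ ∀ i, i ∈ s → x i < c i + t ∧ c i < x i + t) → ¬ x j < v 0) ?_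
        refine .and (isDefinable_lt ι (definableFun_const _) definableFun_coord) (.forall_tuple ?_)
        refine .imp (.and (hK.comp (F := Sum.elim (fun _ w => w (Sum.inl (Sum.inr ())))
          (fun i w => w (Sum.inr i))) ?_) (.forall_finite fun i => .imp (.const _)
            (.and (isDefinable_lt ι definableFun_coord
                (definableFun_add ι (definableFun_const _) definableFun_coord))
              (isDefinable_lt ι (definableFun_const _)
                (definableFun_add ι definableFun_coord definableFun_coord)))))
            (.not (isDefinable_lt ι definableFun_coord definableFun_coord))
        rintro (_ | i) <;> exact definableFun_coord)
      ⟨-ρ, 1, one_pos, fun x hx => not_lt.2 (neg_le_of_abs_le (hρ 1 one_pos x hx.1 j))⟩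
      ⟨ρ, fun u ⟨t, ht, hu⟩ => by
        obtain ⟨x, hx⟩ := hc t ht
        exact (not_lt.1 (hu x hx)).trans (le_of_abs_le (hρ t ht x hx.1 j))⟩
    refine ⟨Function.update c j d, fun t ht => ?_⟩
    obtain ⟨u, ⟨t₀, ht₀, hu⟩, hud⟩ := (lt_isLUB_iff hd).1 (show d - t < d by linarith)
    -- Level `t₀` forces `x j ≥ u > d - t`, while no level forces `x j ≥ d + t`; a point at level
    -- `min t t₀` can meet both bounds.
    have hmin : 0 < min t t₀ := lt_min ht ht₀
    obtain ⟨x, ⟨hxK, hxs⟩, hxd⟩ : ∃ x : Fin n → R, (x ∈ K (min t t₀) ∧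
        ∀ i, i ∈ s → x i < c i + min t t₀ ∧ c i < x i + min t t₀) ∧ x j < d + t := by
      by_contra! H
      have := hd.1 (show d + t ∈ _ from ⟨min t t₀, hmin, fun x hx => not_lt.2 (H x hx)⟩)
      linarith
    have hle := min_le_left t t₀
    have hle₀ := min_le_right t t₀
    have hxu := not_lt.1 (hu x ⟨hmono _ _ hmin hle₀ hxK, fun i hi =>
      ⟨by linarith [(hxs i hi).1], by linarith [(hxs i hi).2]⟩⟩)
    refine ⟨x, hmono _ _ hmin hle hxK, fun i hi => ?_⟩
    rcases eq_or_ne i j with rfl | hij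
    · rw [Function.update_self]
      exact ⟨hxd, by linarith⟩
    · rw [Function.update_of_ne hij]
      have := hxs i ((Finset.mem_insert.1 hi).resolve_left hij)
      exact ⟨by linarith [this.1], by linarith [this.2]⟩

variable [TopologicalSpace R] [OrderTopology R]

theorem mem_of_isClosed_of_forall_abs_sub_lt {n : ℕ} {K : Set (Fin n → R)} (hK : IsClosed K)
    {c : Fin n → R} (hc : ∀ t, 0 < t → ∃ x ∈ K, ∀ i, |x i - c i| < t) : c ∈ K := by
  by_contra hcK
  have hnhds : Kᶜ ∈ nhds c := hK.isOpen_compl.mem_nhds hcK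
  rw [nhds_pi, Filter.mem_pi'] at hnhds
  obtain ⟨I, U, hU, hsub⟩ := hnhds
  have hball : ∀ i, ∃ ε : R, 0 < ε ∧ ∀ b, |b - c i| < ε → b ∈ U i := fun i =>
    (nhds_basis_abs_sub_lt (c i)).mem_iff.1 (hU i)
  choose ε hε hεU using hball
  obtain ⟨δ, hδ, hδε⟩ := Pi.exists_forall_pos_add_lt (x := fun _ => (0 : R)) hε
  obtain ⟨x, hx, hxc⟩ := hc δ hδ
  refine hsub (fun i _ => hεU i _ ((hxc i).trans ?_)) hx
  simpa using hδε i

/-- The projection of a closed and bounded definable set to the first coordinate is closed. -/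
theorem DefinablyComplete.exists_mem_zero_eq (hR : DefinablyComplete L R)
    (ι : ordField →ᴸ L) [ι.IsExpansionOn R] {n : ℕ} {K : Set (Fin (n + 1) → R)}
    (hdef : IsDefinable L K) (hclosed : IsClosed K) {ρ : R} (hρ : ∀ x ∈ K, ∀ i, |x i| ≤ ρ) {s : R}
    (hs : ∀ t, 0 < t → ∃ x ∈ K, x 0 < s + t ∧ s < x 0 + t) : ∃ x ∈ K, x 0 = s := by
  -- The parts of `K` in the slabs of half-width `t` around `x 0 = s` shrink with `t`; they cluster
  -- at a point of the hyperplane.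
  obtain ⟨c, hc⟩ := hR.exists_cluster_point ι
    (K := fun t => {x | x ∈ K ∧ x 0 < s + t ∧ s < x 0 + t}) (ρ := ρ)
    (.and (hdef.comp (F := fun i w => w (Sum.inr i)) fun _ => definableFun_coord)
      (.and (isDefinable_lt ι definableFun_coord
          (definableFun_add ι (definableFun_const _) definableFun_coord))
        (isDefinable_lt ι (definableFun_const _)
          (definableFun_add ι definableFun_coord definableFun_coord))))
    (fun t t' _ htt' x hx => ⟨hx.1, by linarith [hx.2.1], by linarith [hx.2.2]⟩)
    hs (fun t _ x hx => hρ x hx.1)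
  refine ⟨c, mem_of_isClosed_of_forall_abs_sub_lt hclosed fun t ht => ?_, ?_⟩
  · obtain ⟨x, hx, hxc⟩ := hc t ht
    exact ⟨x, hx.1, hxc⟩
  · refine sub_eq_zero.1 (abs_nonpos_iff.1 (le_of_forall_pos_lt_add fun ε hε => ?_))
    obtain ⟨x, ⟨_, h1, h2⟩, hxc⟩ := hc (ε / 2) (half_pos hε)
    have h := abs_sub_lt_iff.1 (hxc 0)
    rw [zero_add]
    exact abs_sub_lt_iff.2 ⟨by linarith [h.2], by linarith [h.1]⟩

end Compactness

/-! ### Helly's theorem, finite and definable. -/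

section Helly

theorem helly_of_forall_tuple {R : Type*} [Field R] [LinearOrder R] [IsStrictOrderedRing R]
    {κ : Type*} [Finite κ] {n : ℕ} {C : κ → Set (Fin n → R)} (hconv : ∀ k, Convex R (C k))
    (h : ∀ f : Fin (n + 1) → κ, ∃ x, ∀ i, x ∈ C (f i)) : ∃ x, ∀ k, x ∈ C k := by
  classical
  have := Fintype.ofFinite κ
  obtain ⟨x, hx⟩ := Convex.helly_theorem' (𝕜 := R) (F := C) (s := Finset.univ)
    (fun k _ => hconv k) (fun I _ hI => by
      rcases I.eq_empty_or_nonempty with rfl | ⟨k₀, hk₀⟩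
      · simp
      · have : Nonempty I := ⟨⟨k₀, hk₀⟩⟩
        obtain ⟨e⟩ := Function.Embedding.nonempty_of_card_le (α := I) (β := Fin (n + 1))
          (by simpa using hI)
        obtain ⟨x, hx⟩ := h fun i => (Function.invFun e i : I)
        refine ⟨x, mem_iInter₂.2 fun k hk => ?_⟩
        have := hx (e ⟨k, hk⟩)
        rwa [Function.leftInverse_invFun e.injective] at this)
  exact ⟨x, fun k => mem_iInter₂.1 hx k (Finset.mem_univ k)⟩

variable {L : FirstOrder.Language.{u, v}} {R : Type w} [Field R] [LinearOrder R]
  [IsStrictOrderedRing R] [L.Structure R]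

theorem Convex.exists_apply_zero_near {n : ℕ} {K : Set (Fin (n + 1) → R)} (hK : Convex R K)
    {s t : R} (ht : 0 < t) {x y : Fin (n + 1) → R} (hx : x ∈ K) (hy : y ∈ K) (hxs : x 0 < s + t)
    (hys : s < y 0 + t) : ∃ z ∈ K, z 0 < s + t ∧ s < z 0 + t := by
  by_cases h1 : s < x 0 + t
  · exact ⟨x, hx, hxs, h1⟩
  by_cases h2 : y 0 < s + t
  · exact ⟨y, hy, h2, hys⟩
  have hpos : 0 < y 0 - x 0 := by linarith
  -- Now `x` and `y` lie on opposite sides of the slab; these weights give the point where their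
  -- segment crosses `x 0 = s`.
  have key : (y 0 - s) / (y 0 - x 0) * x 0 + (s - x 0) / (y 0 - x 0) * y 0 = s := by
    field_simp
    ring
  refine ⟨((y 0 - s) / (y 0 - x 0)) • x + ((s - x 0) / (y 0 - x 0)) • y,
    hK hx hy (div_nonneg (by linarith) hpos.le) (div_nonneg (by linarith) hpos.le)
      (by field_simp; ring), ?_⟩
  simp only [Pi.add_apply, Pi.smul_apply, smul_eq_mul, key]
  exact ⟨by linarith, by linarith⟩

variable [TopologicalSpace R] [OrderTopology R]

theorem DefinablyComplete.helly_of_forall_tuple (hR : DefinablyComplete L R)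
    (ι : ordField →ᴸ L) [ι.IsExpansionOn R] {m n : ℕ} {A : Set (Fin m → R)}
    {C : (Fin m → R) → Set (Fin n → R)} (hdef : IsDefinableFamily L A C) (hA : A.Nonempty)
    (hclosed : ∀ a ∈ A, IsClosed (C a)) (hbdd : ∀ a ∈ A, ∃ ρ, ∀ x ∈ C a, ∀ i, |x i| ≤ ρ)
    (hconv : ∀ a ∈ A, Convex R (C a))
    (hinter : ∀ a : Fin (n + 1) → Fin m → R, (∀ i, a i ∈ A) → ∃ x, ∀ i, x ∈ C (a i)) :
    ∃ x, ∀ a ∈ A, x ∈ C a := by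
  induction n with
  | zero =>
    refine ⟨0, fun a ha => ?_⟩
    obtain ⟨x, hx⟩ := hinter (fun _ => a) fun _ => ha
    rw [Subsingleton.elim 0 x]
    exact hx 0
  | succ n ih =>
    have hfin : ∀ {κ : Type} [Finite κ] (a : κ → Fin m → R), (∀ k, a k ∈ A) →
        ∃ x, ∀ k, x ∈ C (a k) := fun a ha =>
      DefHelly.helly_of_forall_tuple (fun k => hconv _ (ha k)) fun f => hinter _ fun i => ha (f i)
    obtain ⟨a₀, ha₀⟩ := hA
    obtain ⟨ρ, hρ⟩ := hbdd a₀ ha₀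
    -- Strict lower bounds replace minima, which need not be shown to be attained. Membership in `A`
    -- is repeated beside `x ∈ C _` because only their conjunction is known to be definable.
    obtain ⟨s, hs⟩ := hR.exists_isLUB (P := fun t => ∃ a : Fin (n + 1) × Fin m → R,
      (∀ i, (fun j => a (i, j)) ∈ A) ∧ ∀ x : Fin (n + 1) → R,
        (∀ i, (fun j => a (i, j)) ∈ A ∧ x ∈ C fun j => a (i, j)) → t < x 0)
      (by
        refine .exists_tuple (.and (.forall_finite fun i => ?_) (.forall_tuple
          (.imp (.forall_finite fun i => ?_)
            (isDefinable_lt ι definableFun_coord definableFun_coord))))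
        · exact hdef.1.comp (F := fun j w => w (Sum.inr (i, j))) fun j => definableFun_coord
        · exact hdef.mem (f := fun j w => w (Sum.inl (Sum.inr (i, j))))
            (g := fun k w => w (Sum.inr k)) (fun _ => definableFun_coord)
            fun _ => definableFun_coord)
      ⟨-ρ - 1, fun p => a₀ p.2, fun _ => ha₀, fun x hx => by
        linarith [neg_le_of_abs_le (hρ x (hx 0).2 0)]⟩
      ⟨ρ, fun t ⟨a, ha, hat⟩ => by
        -- The bound `ρ` holds on `C a₀` only, as the family need not be uniformly bounded; so `C
        -- a₀` is added to the tuple.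
        obtain ⟨x, hx⟩ := hfin (κ := Option (Fin (n + 1)))
          (fun o => o.elim a₀ fun i j => a (i, j)) (by rintro (_ | i); exacts [ha₀, ha i])
        exact (hat x fun i => ⟨ha i, hx (some i)⟩).le.trans (le_of_abs_le (hρ x (hx none) 0))⟩
    have hslice : ∀ a : Fin (n + 1) → Fin m → R, (∀ i, a i ∈ A) →
        ∃ x, (∀ i, x ∈ C (a i)) ∧ x 0 = s := by
      intro a ha
      obtain ⟨ρ', hρ'⟩ := hbdd _ (ha 0)
      have hKconv : Convex R (⋂ i, C (a i)) := convex_iInter fun i => hconv _ (ha i)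
      obtain ⟨x, hx, hxs⟩ := hR.exists_mem_zero_eq ι (K := ⋂ i, C (a i)) (s := s)
        (Set.definable_iInter_of_finite fun i => by
          have := hdef.mem (f := fun j (_ : Fin (n + 1) → R) => a i j) (g := fun k w => w k)
            (fun j => definableFun_const _) fun _ => definableFun_coord
          convert! this using 1
          ext x
          exact ⟨fun h => ⟨ha i, h⟩, fun h => h.2⟩)
        (isClosed_iInter fun i => hclosed _ (ha i)) (fun x hx => hρ' x (mem_iInter.1 hx 0))
        (fun t ht => by
          obtain ⟨x, hx, hxs⟩ : ∃ x ∈ ⋂ i, C (a i), x 0 < s + t := by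
            by_contra! H
            have := hs.1 (show s + t / 2 ∈ _ from ⟨fun p => a p.1 p.2, ha, fun x hx => by
              linarith [H x (mem_iInter.2 fun i => (hx i).2)]⟩)
            linarith
          obtain ⟨t', ⟨b, hb, hbt⟩, ht'⟩ := (lt_isLUB_iff hs).1 (show s - t < s by linarith)
          -- The two tuples together may exceed `n + 2` sets, hence the use of finite Helly.
          obtain ⟨y, hy⟩ := hfin (κ := Fin (n + 1) ⊕ Fin (n + 1))
            (Sum.elim a fun i j => b (i, j)) (by rintro (i | i); exacts [ha i, hb i])
          have := hbt y fun i => ⟨hb i, hy (Sum.inr i)⟩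
          exact Convex.exists_apply_zero_near hKconv ht hx (mem_iInter.2 fun i => hy (Sum.inl i))
            hxs (by linarith))
      exact ⟨x, mem_iInter.1 hx, hxs⟩
    have hcons : Continuous fun y : Fin n → R => (Fin.cons s y : Fin (n + 1) → R) :=
      continuous_const.finCons continuous_id
    obtain ⟨y, hy⟩ := ih (C := fun a => {y | (Fin.cons s y : Fin (n + 1) → R) ∈ C a})
      ⟨hdef.1, by
        refine hdef.mem (f := fun j w => w (Sum.inl j))
          (g := fun k w => (Fin.cons s fun i => w (Sum.inr i) : Fin (n + 1) → R) k)
          (fun _ => definableFun_coord) (Fin.cases ?_ fun i => ?_)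
        · exact definableFun_const s
        · exact definableFun_coord⟩
      (fun a ha => (hclosed a ha).preimage hcons)
      (fun a ha => by
        obtain ⟨r, hr⟩ := hbdd a ha
        exact ⟨r, fun y hy i => hr _ hy i.succ⟩)
      (fun a ha x hx y hy p q hp hq hpq => by
        have h : (Fin.cons s (p • x + q • y) : Fin (n + 1) → R) =
            p • Fin.cons s x + q • Fin.cons s y := by
          ext i
          refine Fin.cases ?_ (fun i => ?_) i
          · simp [← add_mul, hpq]
          · simp
        change Fin.cons s (p • x + q • y) ∈ C a
        rw [h]
        exact hconv a ha hx hy hp hq hpq)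
      (fun a ha => by
        obtain ⟨x, hx, hxs⟩ := hslice a ha
        refine ⟨Fin.tail x, fun i => ?_⟩
        change Fin.cons s (Fin.tail x) ∈ C (a i)
        rw [← hxs, Fin.cons_self_tail]
        exact hx i)
    exact ⟨_, hy⟩

end Helly

end DefHelly

/-- The language map `ι` names symbols of `L` for `0, 1, +, ·, <`, and `ι.IsExpansionOn R` says that
the `L`-structure `R` interprets them as in the ordered field `R`: it is an expansion of the
ordered field. The space `R^n` carries the product of the order topologies. -/
theorem theorem2 {R : Type w} [Field R] [LinearOrder R] [IsStrictOrderedRing R]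
    [TopologicalSpace R] [OrderTopology R]
    (L : FirstOrder.Language.{u, v}) [L.Structure R]
    (ι : DefHelly.ordField →ᴸ L) [ι.IsExpansionOn R]
    (hR : DefHelly.DefinablyComplete L R)
    {m n : ℕ} (A : Set (Fin m → R)) (C : (Fin m → R) → Set (Fin n → R))
    (hdef : DefHelly.IsDefinableFamily L A C)
    (hclosed : ∀ a ∈ A, IsClosed (C a))
    (hbdd : ∀ a ∈ A, DefHelly.IsBoundedSet (C a))
    (hconv : ∀ a ∈ A, Convex R (C a))
    (hinter : ∀ F : Finset (Fin m → R), (∀ a ∈ F, a ∈ A) → F.card ≤ n + 1 →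
      (⋂ a ∈ F, C a).Nonempty) :
    (⋂ a ∈ A, C a).Nonempty := by
  classical
  rcases A.eq_empty_or_nonempty with rfl | hA
  · simp
  obtain ⟨x, hx⟩ := hR.helly_of_forall_tuple ι hdef hA hclosed
    (fun a ha => by
      obtain ⟨ρ, hρ, h⟩ := hbdd a ha
      refine ⟨ρ, fun x hx i => (abs_lt_of_sq_lt_sq ?_ hρ.le).le⟩
      exact (Finset.single_le_sum (f := fun i => x i ^ 2) (fun i _ => sq_nonneg (x i))
        (Finset.mem_univ i)).trans_lt (h x hx))
    hconv
    (fun a ha => by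
      obtain ⟨x, hx⟩ := hinter (Finset.univ.image a) (by simpa using ha)
        (Finset.card_image_le.trans (by simp))
      exact ⟨x, fun i => Set.mem_iInter₂.1 hx (a i)
        (Finset.mem_image_of_mem a (Finset.mem_univ i))⟩)
  exact ⟨x, Set.mem_iInter₂.2 hx⟩
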